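/- Let $c_1>0$ and $c_2\ge 0$ be real numbers. For an integer $n>\max(c_1,c_2)$ let $A_n$ be a set of $n$ atoms. A random negative two-literal program $P$ on $A_n$ under the linear model is a random set of rules $a\leftarrow \mathrm{not}\ b$ with $a,b\in A_n$, in which each pure rule $a\leftarrow \mathrm{not}\ b$ ($a\ne b$) is contained with probability $c_1/n$ and each contradiction rule $a\leftarrow\mathrm{not}\ a$ with probability $c_2/n$, all independently. A set $S\subseteq A_n$ is an answer set of $P$ if $S$ is the least model of the reduct $P^S=\{a\leftarrow\ \mid\ (a\leftarrow\mathrm{not}\ b)\in P,\ b\notin S\}$, i.e. if $S=\{a \mid (a\leftarrow\mathrm{not}\ b)\in P \text{ for some } b\notin S\}$; let $\mathrm{AS}(P)$ be the set of answer sets of $P$. Then the equation $\ln\alpha=c_1/\alpha$ has exactly one solution $\alpha>0$, this solution satisfies $\alpha>1$, and $$\lim_{n\to\infty}E\bigl[|\mathrm{AS}(P)|\bigr]=\frac{\alpha\,e^{(c_1-c_2)/\alpha}}{\alpha+c_1}.$$ The same limit holds for the conditional expectation $E\bigl[|\mathrm{AS}(P)|\,\big|\,P\neq\emptyset\bigr]$,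 that is, if the random program is required to contain at least one rule. -/

import Mathlib

open MeasureTheory ProbabilityTheory Filter Topology

noncomputable section

namespace ASP

variable {A : Type*}

/-- A rule `a ← b₁, …, b_s, not c₁, …, not c_t` of a normal logic program over the atoms `A`,
with `head = a`, `posBody = {b₁, …, b_s}` and `negBody = {c₁, …, c_t}`. The atoms in the body are
pairwise distinct. -/
structure Rule (A : Type*) where
  head : A
  posBody : Finset A
  negBody : Finset A
  disjoint_body : Disjoint posBody negBody

/-- `S ⊨ R`: the head of `R` is in `S` whenever the positive body is contained in `S` and the
negative body does not meet `S`. -/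
def Rule.SatisfiedBy (R : Rule A) (S : Set A) : Prop :=
  (∀ b ∈ R.posBody, b ∈ S) → (∀ c ∈ R.negBody, c ∉ S) → R.head ∈ S

/-- The positive rule `head(R) ← body⁺(R)`. -/
def Rule.positivePart (R : Rule A) : Rule A where
  head := R.head
  posBody := R.posBody
  negBody := ∅
  disjoint_body := Finset.disjoint_empty_right _

/-- `S` is a model of the program `P`. -/
def IsModel (P : Set (Rule A)) (S : Set A) : Prop :=
  ∀ R ∈ P, R.SatisfiedBy S

/-- The (Gelfond–Lifschitz) reduct `P^S`. -/
def reduct (P : Set (Rule A)) (S : Set A) : Set (Rule A) :=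
  Rule.positivePart '' {R ∈ P | ∀ c ∈ R.negBody, c ∉ S}

/-- `S` is an answer set of `P` if it is the least model of the reduct `P^S`. -/
def IsAnswerSet (P : Set (Rule A)) (S : Set A) : Prop :=
  IsLeast {M : Set A | IsModel (reduct P S) M} S

/-- The collection of all answer sets of `P`. -/
def answerSets (P : Set (Rule A)) : Set (Set A) :=
  {S | IsAnswerSet P S}

/-- The negative two-literal rule `a ← not b` (a pure rule if `a ≠ b`, a contradiction rule if
`a = b`). -/
def negRule (a b : A) : Rule A where
  head := a
  posBody := ∅
  negBody := {b}
  disjoint_body := Finset.disjoint_empty_left _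

/-- The negative two-literal program consisting of the rules `a ← not b` with `(a, b) ∈ E`. -/
def negProgram (E : Set (A × A)) : Set (Rule A) :=
  (fun r : A × A => negRule r.1 r.2) '' E

/-- The probability with which the rule `a ← not b`, coded as `(a, b)`, is selected in the linear
model on `n` atoms: `c₁ / n` for a pure rule, `c₂ / n` for a contradiction rule. -/
def ruleProb (c₁ c₂ : ℝ) (n : ℕ) (r : Fin n × Fin n) : ℝ :=
  if r.1 = r.2 then c₂ / n else c₁ / n

/-- The linear model on `n` atoms, for `n > max c₁ c₂`: the law of the random set of pairs `(a, b)`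
for which the rule `a ← not b` is in the program, where each pair is selected independently with
probability `ruleProb c₁ c₂ n (a, b)`. (It is a product of Bernoulli measures, transported from
indicator functions to sets.) -/
def linearModel (c₁ c₂ : ℝ) (n : ℕ) : Measure (Set (Fin n × Fin n)) :=
  (Measure.pi fun r : Fin n × Fin n =>
    (ruleProb c₁ c₂ n r).toNNReal • Measure.dirac True +
      (1 - ruleProb c₁ c₂ n r).toNNReal • Measure.dirac False).map
    fun f : Fin n × Fin n → Prop => {r | f r}

/-- The number of answer sets of the negative two-literal program with set of rules `E`. -/
def numAnswerSets {n : ℕ} (E : Set (Fin n × Fin n)) : ℕ :=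
  (answerSets (negProgram E)).ncard

end ASP

end

/-!
Write `p = c₁ / n`, `q = c₂ / n` and `y m = (1 - p) ^ m`. A set whose complement has `m` elements is
an answer set with probability `(1 - y m) ^ (n - m) * ((1 - p) ^ (m - 1) * (1 - q)) ^ m`, because the
conditions on the rules with different heads are independent. Hence the expected number of answer
sets is `∑ m, T m * g m`, where `T m` is the probability that a binomial variable with parameters `n`
and `y m` equals `m`, and `g m = ((1 - q) / (1 - p)) ^ m`
(`integral_numAnswerSets_eq_sum_binomialMass`).

The sum of the `T m` is evaluated without Stirling's formula. Let `F m` be the probability that a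
binomial variable with parameters `n` and `y m` is at least `m`. Then `F` decreases from `F 0 = 1` to
`F (n + 1) = 0`. The decrement `F m - F (m + 1)` is the sum of `T m` and of the effect of lowering
the parameter from `y m` to `y (m + 1)`; the latter is nonnegative, and by the mean value theorem it
equals `T m * R` with an explicit factor `R = relativeDrop …` (`exists_binomialTail_sub_eq`). If `x`
is the solution of `exp (-c₁ x) = x`, that is `x = 1 / α`, then `R → c₁ x` and
`g m → exp ((c₁ - c₂) x)` as `n → ∞` and `m / n → x` (`tendsto_relativeDrop`). So in a window around
`m = x n` the summand `T m * g m` is close to `K * (F m - F (m + 1))` with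
`K = exp ((c₁ - c₂) x) / (1 + c₁ x)`. By Chebyshev's inequality `F` is close to `1` to the left of the
window and close to `0` to its right, so the decrements outside of the window, which dominate the
`T m`, have a negligible sum, and those inside sum up to almost `1`
(`tendsto_sum_binomialMass_mul`).

Requiring the program to be nonempty changes nothing in the limit, since the empty program has
exactly one answer set and its probability tends to `0`.
-/

namespace ASP

/-! ### Answer sets of negative two-literal programs -/

/-- The reduct consists of facts, so its least model is the set of their heads. -/
lemma isAnswerSet_negProgram_iff {A : Type*} (E : Set (A × A)) (S : Set A) :
    IsAnswerSet (negProgram E) S ↔ ∀ a, a ∈ S ↔ ∃ b, b ∉ S ∧ (a, b) ∈ E := by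
  have hmodels : {M : Set A | IsModel (reduct (negProgram E) S) M} =
      Set.Ici {a | ∃ b, b ∉ S ∧ (a, b) ∈ E} := by
    ext M
    simp only [IsModel, reduct, negProgram, Set.mem_ofPred_eq, Set.mem_Ici]
    constructor
    · rintro h a ⟨b, hb, hab⟩
      refine h (negRule a b).positivePart ⟨negRule a b, ⟨⟨(a, b), hab, rfl⟩, ?_⟩, rfl⟩ ?_ ?_
      · simpa [negRule] using hb
      · simp [negRule, Rule.positivePart]
      · simp [Rule.positivePart]
    · rintro h R ⟨R', ⟨⟨⟨a, b⟩, hab, rfl⟩, hR'⟩, rfl⟩ - -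
      exact h ⟨b, by simpa [negRule] using hR', hab⟩
  rw [IsAnswerSet, hmodels]
  constructor
  · intro h a
    exact Set.ext_iff.1 (h.unique isLeast_Ici) a
  · intro h
    have : S = {a | ∃ b, b ∉ S ∧ (a, b) ∈ E} := Set.ext h
    rw [← this]
    exact isLeast_Ici

open Classical in
/-- Answer sets are indexed by their complements `U`. Each factor of the product involves only the
rules with one given head, which makes the expected value of the product factor. -/
lemma numAnswerSets_eq_sum {n : ℕ} (E : Set (Fin n × Fin n)) :
    (numAnswerSets E : ℝ) = ∑ U : Finset (Fin n),
      ∏ a, if a ∉ U ↔ ∃ b ∈ U, (a, b) ∈ E then 1 else 0 := by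
  have h : answerSets (negProgram E) = (fun U : Finset (Fin n) => (U : Set (Fin n))ᶜ) ''
      (Finset.univ.filter fun U : Finset (Fin n) => ∀ a, a ∉ U ↔ ∃ b ∈ U, (a, b) ∈ E) := by
    ext S
    simp only [answerSets, Set.mem_ofPred_eq, isAnswerSet_negProgram_iff, Finset.coe_filter,
      Finset.mem_univ, true_and, Set.mem_image]
    constructor
    · intro hS
      refine ⟨Sᶜ.toFinset, ?_, by simp⟩
      simpa using hS
    · rintro ⟨U, hU, rfl⟩
      simpa using hU
  have hinj : Function.Injective (fun U : Finset (Fin n) => (U : Set (Fin n))ᶜ) :=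
    compl_injective.comp Finset.coe_injective
  rw [numAnswerSets, h, Set.ncard_image_of_injective _ hinj, Set.ncard_coe_finset,
    Finset.card_filter]
  push_cast
  refine Finset.sum_congr rfl fun U _ => ?_
  simp [Finset.prod_ite_zero]

lemma numAnswerSets_empty (n : ℕ) : numAnswerSets (∅ : Set (Fin n × Fin n)) = 1 := by
  have h : answerSets (negProgram (∅ : Set (Fin n × Fin n))) = {∅} := by
    ext S
    simp [answerSets, isAnswerSet_negProgram_iff, Set.eq_empty_iff_forall_notMem]
  rw [numAnswerSets, h, Set.ncard_singleton]

/-! ### The expected number of answer sets in the linear model -/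

/-- The law of the indicator function of the random set of rules in the linear model. -/
noncomputable abbrev indicatorLaw (c₁ c₂ : ℝ) (n : ℕ) : Measure (Fin n × Fin n → Prop) :=
  Measure.pi fun r : Fin n × Fin n =>
    (ruleProb c₁ c₂ n r).toNNReal • Measure.dirac True +
      (1 - ruleProb c₁ c₂ n r).toNNReal • Measure.dirac False

lemma bernoulli_apply {p : ℝ} (s : Set Prop) [DecidablePred (· ∈ s)] :
    (p.toNNReal • Measure.dirac True + (1 - p).toNNReal • Measure.dirac False : Measure Prop) s =
      ENNReal.ofReal p * (if True ∈ s then 1 else 0) +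
        ENNReal.ofReal (1 - p) * (if False ∈ s then 1 else 0) := by
  rw [Measure.add_apply, Measure.smul_apply, Measure.smul_apply, Measure.dirac_apply,
    Measure.dirac_apply, ENNReal.smul_def, ENNReal.smul_def, smul_eq_mul, smul_eq_mul]
  simp only [Set.indicator_apply, Pi.one_apply]
  rfl

open Classical in
lemma indicatorLaw_real_singleton {c₁ c₂ : ℝ} {n : ℕ}
    (h : ∀ r, ruleProb c₁ c₂ n r ∈ Set.Icc 0 1) (f : Fin n × Fin n → Prop) :
    (indicatorLaw c₁ c₂ n).real {f} =
      ∏ r, if f r then ruleProb c₁ c₂ n r else 1 - ruleProb c₁ c₂ n r := by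
  rw [Measure.real, Measure.pi_singleton, ENNReal.toReal_prod]
  refine Finset.prod_congr rfl fun r _ => ?_
  rw [bernoulli_apply]
  by_cases hf : f r
  · simp [hf, (h r).1]
  · simp [hf, (h r).2]

lemma measurable_setOf_indicator (n : ℕ) :
    Measurable (fun f : Fin n × Fin n → Prop => {r | f r}) := by
  fun_prop


open Classical in
/-- Independence of the rows of a random `A × A` matrix with independent entries: the expected value
of a product of functions of single rows is the product of their expected values. -/
lemma sum_indicator_prod_rows {A : Type*} [Fintype A] (v : A × A → Prop → ℝ)
    (h : A → (A → Prop) → ℝ) :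
    ∑ f : A × A → Prop, (∏ r, v r (f r)) * ∏ a, h a (fun b => f (a, b)) =
      ∏ a, ∑ g : A → Prop, (∏ b, v (a, b) (g b)) * h a g := by
  rw [Finset.prod_univ_sum, Fintype.piFinset_univ]
  refine Fintype.sum_equiv (Equiv.curry A A Prop) _ _ fun f => ?_
  rw [Finset.prod_mul_distrib, Fintype.prod_prod_type]
  rfl

open Classical in
/-- The probability that no element of `U` is selected, if each `b` is selected independently with
probability `w b`. -/
lemma sum_row_none {A : Type*} [Fintype A] (w : A → ℝ) (U : Finset A) :
    ∑ g : A → Prop, (∏ b, if g b then w b else 1 - w b) *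
      (if ∃ b ∈ U, g b then 0 else 1) = ∏ b ∈ U, (1 - w b) := by
  have h : ∀ g : A → Prop, (∏ b, if g b then w b else 1 - w b) *
      (if ∃ b ∈ U, g b then (0 : ℝ) else 1) =
      ∏ b, (if g b then w b else 1 - w b) * (if b ∈ U → ¬ g b then 1 else 0) := by
    intro g
    rw [Finset.prod_mul_distrib, Finset.prod_ite_zero]
    by_cases hg : ∃ b ∈ U, g b
    · have : ¬ ∀ b, b ∈ U → ¬ g b := by push Not; exact hg
      simp only [if_pos hg, Finset.mem_univ, true_implies, if_neg this]
    · have : ∀ b, b ∈ U → ¬ g b := by push Not at hg; exact hg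
      simp only [if_neg hg, Finset.mem_univ, true_implies, if_pos this, Finset.prod_const_one]
  simp_rw [h]
  have := Finset.prod_univ_sum (ι := A) (κ := fun _ => Prop) (fun _ => Finset.univ)
    (fun b (x : Prop) => (if x then w b else 1 - w b) * (if b ∈ U → ¬ x then 1 else 0))
  rw [Fintype.piFinset_univ] at this
  rw [← this, ← Finset.prod_subset (Finset.subset_univ U)]
  · refine Finset.prod_congr rfl fun b hb => ?_
    simp [hb]
  · intro b _ hb
    simp [hb]

open Classical in
/-- The probability that some element of `U` is selected, if each `b` is selected independently with
probability `w b`. -/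
lemma sum_row_some {A : Type*} [Fintype A] (w : A → ℝ) (U : Finset A) :
    ∑ g : A → Prop, (∏ b, if g b then w b else 1 - w b) *
      (if ∃ b ∈ U, g b then 1 else 0) = 1 - ∏ b ∈ U, (1 - w b) := by
  have h1 := sum_row_none w U
  have h0 := sum_row_none w ∅
  simp only [Finset.notMem_empty, false_and, exists_false, if_false, mul_one,
    Finset.prod_empty] at h0
  rw [← h1]
  refine Eq.trans ?_ (congrArg (· - _) h0)
  rw [← Finset.sum_sub_distrib]
  refine Finset.sum_congr rfl fun g _ => ?_
  rw [← mul_one_sub]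
  congr 1
  split_ifs <;> simp

lemma prod_one_sub_ruleProb_of_notMem {n : ℕ} (c₁ c₂ : ℝ) {U : Finset (Fin n)} {a : Fin n}
    (ha : a ∉ U) : ∏ b ∈ U, (1 - ruleProb c₁ c₂ n (a, b)) = (1 - c₁ / n) ^ U.card := by
  rw [← Finset.prod_const]
  refine Finset.prod_congr rfl fun b hb => ?_
  have : a ≠ b := fun h => ha (h ▸ hb)
  simp [ruleProb, this]

lemma prod_one_sub_ruleProb_of_mem {n : ℕ} (c₁ c₂ : ℝ) {U : Finset (Fin n)} {a : Fin n}
    (ha : a ∈ U) : ∏ b ∈ U, (1 - ruleProb c₁ c₂ n (a, b)) =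
      (1 - c₁ / n) ^ (U.card - 1) * (1 - c₂ / n) := by
  rw [← Finset.prod_erase_mul _ _ ha, prod_one_sub_ruleProb_of_notMem c₁ c₂ (U.notMem_erase a),
    Finset.card_erase_of_mem ha]
  simp [ruleProb]

lemma integral_linearModel {c₁ c₂ : ℝ} {n : ℕ} (X : Set (Fin n × Fin n) → ℝ) :
    ∫ E, X E ∂linearModel c₁ c₂ n = ∫ f, X {r | f r} ∂indicatorLaw c₁ c₂ n :=
  integral_map (measurable_setOf_indicator n).aemeasurable
    (Measurable.of_discrete).aestronglyMeasurable

open Classical in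
/-- The `m`-th summand counts the answer sets whose complement has `m` elements. -/
lemma integral_numAnswerSets {c₁ c₂ : ℝ} {n : ℕ}
    (h : ∀ r, ruleProb c₁ c₂ n r ∈ Set.Icc 0 1) :
    ∫ E, (numAnswerSets E : ℝ) ∂linearModel c₁ c₂ n =
      ∑ m ∈ Finset.range (n + 1), (n.choose m : ℝ) *
        ((1 - (1 - c₁ / n) ^ m) ^ (n - m) * ((1 - c₁ / n) ^ (m - 1) * (1 - c₂ / n)) ^ m) := by
  rw [integral_linearModel, integral_fintype (Integrable.of_finite)]
  simp_rw [numAnswerSets_eq_sum, indicatorLaw_real_singleton h, smul_eq_mul, Finset.mul_sum]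
  rw [Finset.sum_comm]
  have key : ∀ U : Finset (Fin n), ∑ f : Fin n × Fin n → Prop,
      (∏ r, if f r then ruleProb c₁ c₂ n r else 1 - ruleProb c₁ c₂ n r) *
        ∏ a, (if a ∉ U ↔ ∃ b ∈ U, (a, b) ∈ {r | f r} then (1 : ℝ) else 0) =
      (1 - (1 - c₁ / n) ^ U.card) ^ (n - U.card) *
        ((1 - c₁ / n) ^ (U.card - 1) * (1 - c₂ / n)) ^ U.card := by
    intro U
    have h1 := sum_indicator_prod_rows (A := Fin n)
      (fun r x => if x then ruleProb c₁ c₂ n r else 1 - ruleProb c₁ c₂ n r)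
      (fun a g => if a ∉ U ↔ ∃ b ∈ U, g b then (1 : ℝ) else 0)
    refine (Eq.trans (by congr!) h1).trans ?_
    rw [← Finset.prod_compl_mul_prod U]
    congr 1
    · have hcard : n - U.card = Uᶜ.card := by rw [Finset.card_compl, Fintype.card_fin]
      rw [hcard, ← Finset.prod_const]
      refine Finset.prod_congr rfl fun a ha => ?_
      rw [Finset.mem_compl] at ha
      simp only [ha, not_false_eq_true, true_iff]
      rw [← prod_one_sub_ruleProb_of_notMem c₁ c₂ ha,
        ← sum_row_some (fun b => ruleProb c₁ c₂ n (a, b)) U]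
      congr!
    · rw [← Finset.prod_const]
      refine Finset.prod_congr rfl fun a ha => ?_
      simp only [ha, not_true_eq_false, false_iff, ite_not]
      rw [← prod_one_sub_ruleProb_of_mem c₁ c₂ ha,
        ← sum_row_none (fun b => ruleProb c₁ c₂ n (a, b)) U]
      congr!
  rw [Finset.sum_congr rfl fun U _ => key U]
  have := Finset.sum_powerset_apply_card (fun m => (1 - (1 - c₁ / n : ℝ) ^ m) ^ (n - m) *
        ((1 - c₁ / n) ^ (m - 1) * (1 - c₂ / n)) ^ m) (x := (Finset.univ : Finset (Fin n)))
  simpa using this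

lemma linearModel_real_empty {c₁ c₂ : ℝ} {n : ℕ}
    (h : ∀ r, ruleProb c₁ c₂ n r ∈ Set.Icc 0 1) :
    (linearModel c₁ c₂ n).real {∅} = ((1 - c₁ / n) ^ (n - 1) * (1 - c₂ / n)) ^ n := by
  rw [linearModel, map_measureReal_apply (measurable_setOf_indicator n) (measurableSet_singleton _)]
  have : (fun f : Fin n × Fin n → Prop => {r | f r}) ⁻¹' {∅} = {fun _ => False} := by
    ext f
    simp [Set.ext_iff, funext_iff]
  rw [this, indicatorLaw_real_singleton h]
  simp only [if_false, Fintype.prod_prod_type]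
  rw [Finset.prod_congr rfl fun a _ => prod_one_sub_ruleProb_of_mem c₁ c₂ (Finset.mem_univ a)]
  simp

lemma isProbabilityMeasure_linearModel {c₁ c₂ : ℝ} {n : ℕ}
    (h : ∀ r, ruleProb c₁ c₂ n r ∈ Set.Icc 0 1) : IsProbabilityMeasure (linearModel c₁ c₂ n) := by
  have (r : Fin n × Fin n) : IsProbabilityMeasure
      ((ruleProb c₁ c₂ n r).toNNReal • Measure.dirac True +
        (1 - ruleProb c₁ c₂ n r).toNNReal • Measure.dirac False : Measure Prop) := by
    constructor
    classical
    rw [bernoulli_apply]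
    simp [← ENNReal.ofReal_add (h r).1 (sub_nonneg.2 (h r).2)]
  exact Measure.isProbabilityMeasure_map (measurable_setOf_indicator n).aemeasurable

/-- Conditioning on the program being nonempty removes the empty program, whose only answer set is
the empty set. -/
lemma integral_numAnswerSets_cond_nonempty {c₁ c₂ : ℝ} {n : ℕ}
    (h : ∀ r, ruleProb c₁ c₂ n r ∈ Set.Icc 0 1) :
    ∫ E, (numAnswerSets E : ℝ) ∂(cond (linearModel c₁ c₂ n) {E | E.Nonempty}) =
      (1 - (linearModel c₁ c₂ n).real {∅})⁻¹ *
        (∫ E, (numAnswerSets E : ℝ) ∂linearModel c₁ c₂ n - (linearModel c₁ c₂ n).real {∅}) := by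
  have := isProbabilityMeasure_linearModel h
  have hs : {E : Set (Fin n × Fin n) | E.Nonempty} = {∅}ᶜ := by
    ext E
    simp [Set.nonempty_iff_ne_empty]
  rw [hs, ProbabilityTheory.cond, integral_smul_measure,
    ← probReal_compl_eq_one_sub (measurableSet_singleton _),
    ← integral_add_compl (measurableSet_singleton (∅ : Set (Fin n × Fin n)))
      (μ := linearModel c₁ c₂ n) (Integrable.of_finite)]
  simp [numAnswerSets_empty, Measure.real]

/-! ### Binomial masses and tails -/

/-- The probability that a binomial random variable with parameters `n` and `y` equals `k`. It is
`0` for `k > n`. -/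
noncomputable def binomialMass (n k : ℕ) (y : ℝ) : ℝ :=
  n.choose k * y ^ k * (1 - y) ^ (n - k)

/-- The probability that a binomial random variable with parameters `n` and `y` is at least `k`. -/
noncomputable def binomialTail (n k : ℕ) (y : ℝ) : ℝ :=
  ∑ j ∈ Finset.range (n + 1), if k ≤ j then binomialMass n j y else 0

lemma eval_bernsteinPolynomial (n k : ℕ) (y : ℝ) :
    (bernsteinPolynomial ℝ n k).eval y = binomialMass n k y := by
  simp [bernsteinPolynomial, binomialMass]

lemma binomialMass_nonneg (n k : ℕ) {y : ℝ} (hy : y ∈ Set.Icc (0 : ℝ) 1) :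
    0 ≤ binomialMass n k y :=
  mul_nonneg (mul_nonneg (Nat.cast_nonneg _) (pow_nonneg hy.1 _))
    (pow_nonneg (sub_nonneg.2 hy.2) _)

lemma sum_binomialMass (n : ℕ) (y : ℝ) :
    ∑ k ∈ Finset.range (n + 1), binomialMass n k y = 1 := by
  have := congrArg (Polynomial.eval y) (bernsteinPolynomial.sum ℝ n)
  simpa [Polynomial.eval_finsetSum, eval_bernsteinPolynomial] using this

lemma sum_sq_mul_binomialMass (n : ℕ) (y : ℝ) :
    ∑ k ∈ Finset.range (n + 1), (n * y - k) ^ 2 * binomialMass n k y = n * y * (1 - y) := by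
  have := congrArg (Polynomial.eval y) (bernsteinPolynomial.variance ℝ n)
  simpa [Polynomial.eval_finsetSum, eval_bernsteinPolynomial] using this

lemma binomialTail_zero (n : ℕ) (y : ℝ) : binomialTail n 0 y = 1 := by
  simp [binomialTail, sum_binomialMass]

lemma binomialTail_of_lt {n k : ℕ} (h : n < k) (y : ℝ) : binomialTail n k y = 0 :=
  Finset.sum_eq_zero fun j hj => if_neg (by rw [Finset.mem_range] at hj; omega)

lemma binomialTail_succ (n k : ℕ) (y : ℝ) :
    binomialTail n (k + 1) y = binomialTail n k y - binomialMass n k y := by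
  have h : binomialMass n k y =
      ∑ j ∈ Finset.range (n + 1), if j = k then binomialMass n j y else 0 := by
    rw [Finset.sum_ite_eq']
    split_ifs with hk
    · rfl
    · rw [Finset.mem_range] at hk
      simp [binomialMass, Nat.choose_eq_zero_of_lt (show n < k by omega)]
  rw [h, binomialTail, binomialTail, ← Finset.sum_sub_distrib]
  refine Finset.sum_congr rfl fun j _ => ?_
  rcases lt_trichotomy j k with hj | rfl | hj
  · rw [if_neg (by omega), if_neg (by omega), if_neg (by omega), sub_zero]
  · simp
  · rw [if_pos (by omega), if_pos (by omega), if_neg (by omega), sub_zero]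

lemma binomialTail_nonneg (n k : ℕ) {y : ℝ} (hy : y ∈ Set.Icc (0 : ℝ) 1) :
    0 ≤ binomialTail n k y := by
  refine Finset.sum_nonneg fun j _ => ?_
  split_ifs
  exacts [binomialMass_nonneg _ _ hy, le_rfl]

lemma binomialTail_le_one (n k : ℕ) {y : ℝ} (hy : y ∈ Set.Icc (0 : ℝ) 1) :
    binomialTail n k y ≤ 1 := by
  refine (Finset.sum_le_sum fun j _ => ?_).trans_eq (sum_binomialMass n y)
  split_ifs
  exacts [le_rfl, binomialMass_nonneg _ _ hy]

/-- The derivatives of the Bernstein polynomials telescope. -/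
lemma hasDerivAt_binomialTail_succ (n k : ℕ) (y : ℝ) :
    HasDerivAt (binomialTail n (k + 1)) (n * binomialMass (n - 1) k y) y := by
  have hmass : ∀ j, HasDerivAt (binomialMass n j)
      ((Polynomial.derivative (bernsteinPolynomial ℝ n j)).eval y) y := fun j => by
    have := (bernsteinPolynomial ℝ n j).hasDerivAt y
    simpa only [eval_bernsteinPolynomial] using this
  have hsucc : ∀ j, binomialTail n (j + 1) = binomialTail n j - binomialMass n j := fun j =>
    funext fun z => binomialTail_succ n j z
  induction k with
  | zero =>
    have h0 : binomialTail n 0 = fun _ => 1 := funext (binomialTail_zero n)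
    rw [hsucc, h0]
    refine ((hasDerivAt_const y (1 : ℝ)).sub (hmass 0)).congr_deriv ?_
    rw [bernsteinPolynomial.derivative_zero]
    simp [eval_bernsteinPolynomial]
  | succ k ih =>
    rw [hsucc]
    refine (ih.sub (hmass (k + 1))).congr_deriv ?_
    rw [bernsteinPolynomial.derivative_succ]
    simp [eval_bernsteinPolynomial]
    ring

lemma monotoneOn_binomialTail (n k : ℕ) : MonotoneOn (binomialTail n k) (Set.Icc 0 1) := by
  cases k with
  | zero =>
    intro a _ b _ _
    rw [binomialTail_zero, binomialTail_zero]
  | succ k =>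
    refine monotoneOn_of_deriv_nonneg (convex_Icc 0 1)
      (fun y _ => (hasDerivAt_binomialTail_succ n k y).continuousAt.continuousWithinAt)
      (fun y _ => (hasDerivAt_binomialTail_succ n k y).differentiableAt.differentiableWithinAt)
      fun y hy => ?_
    rw [(hasDerivAt_binomialTail_succ n k y).deriv]
    exact mul_nonneg (Nat.cast_nonneg _) (binomialMass_nonneg _ _ (interior_subset hy))

/-- Chebyshev's inequality for the upper tail. -/
lemma binomialTail_le {n k : ℕ} {y η : ℝ} (hn : 0 < n) (hη : 0 < η)
    (hy : y ∈ Set.Icc (0 : ℝ) 1) (hk : y + η ≤ k / n) : binomialTail n k y ≤ 1 / (n * η ^ 2) := by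
  have hn' : (0 : ℝ) < n := Nat.cast_pos.2 hn
  rw [le_div_iff₀ (by positivity)] at hk ⊢
  have h : binomialTail n k y * (n * η) ^ 2 ≤ n * y * (1 - y) := by
    rw [← sum_sq_mul_binomialMass, binomialTail, Finset.sum_mul]
    refine Finset.sum_le_sum fun j _ => ?_
    have hm := binomialMass_nonneg n j hy
    split_ifs with hj
    · rw [mul_comm]
      refine mul_le_mul_of_nonneg_right ?_ hm
      have : (k : ℝ) ≤ j := Nat.cast_le.2 hj
      exact sq_le_sq' (by nlinarith) (by nlinarith) |>.trans_eq (by ring : ((j : ℝ) - n * y) ^ 2 = _)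
    · rw [zero_mul]; positivity
  have h2 : (n : ℝ) * y * (1 - y) ≤ n := by nlinarith [hy.1, hy.2, mul_nonneg hn'.le hy.1]
  have h3 : n * (binomialTail n k y * (n * η ^ 2)) ≤ n * 1 := by linarith
  exact le_of_mul_le_mul_left h3 hn'

/-- Chebyshev's inequality for the lower tail. -/
lemma one_sub_binomialTail_le {n k : ℕ} {y η : ℝ} (hn : 0 < n) (hη : 0 < η)
    (hy : y ∈ Set.Icc (0 : ℝ) 1) (hk : k / n ≤ y - η) :
    1 - binomialTail n k y ≤ 1 / (n * η ^ 2) := by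
  have hn' : (0 : ℝ) < n := Nat.cast_pos.2 hn
  rw [div_le_iff₀ hn'] at hk
  rw [le_div_iff₀ (by positivity)]
  have h : (1 - binomialTail n k y) * (n * η) ^ 2 ≤ n * y * (1 - y) := by
    rw [← sum_sq_mul_binomialMass, binomialTail, ← sum_binomialMass n y,
      ← Finset.sum_sub_distrib, Finset.sum_mul]
    refine Finset.sum_le_sum fun j _ => ?_
    have hm := binomialMass_nonneg n j hy
    split_ifs with hj
    · rw [sub_self, zero_mul]; positivity
    · rw [mul_comm, sub_zero]
      refine mul_le_mul_of_nonneg_right ?_ hm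
      have : (j : ℝ) ≤ k := Nat.cast_le.2 (by omega)
      have hpos : 0 < n * η := mul_pos hn' hη
      exact pow_le_pow_left₀ hpos.le (by nlinarith) 2
  have h2 : (n : ℝ) * y * (1 - y) ≤ n := by nlinarith [hy.1, hy.2, mul_nonneg hn'.le hy.1]
  have h3 : n * ((1 - binomialTail n k y) * (n * η ^ 2)) ≤ n * 1 := by linarith
  exact le_of_mul_le_mul_left h3 hn'

/-- The relative contribution to the decrement `binomialTail n m y - binomialTail n (m + 1) y'`,
`y' = (1 - p) * y`, that stems from the change of the parameter from `y` to `y'`. The mean value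
theorem evaluates it at an intermediate parameter `(1 - θ * p) * y`. -/
noncomputable def relativeDrop (n m : ℕ) (p y θ : ℝ) : ℝ :=
  (n - m) * p * y / (1 - (1 - θ * p) * y) *
    ((1 - θ * p) ^ m * ((1 - (1 - θ * p) * y) / (1 - y)) ^ (n - m))

/-- The derivative of the upper tail in the parameter is a multiple of a binomial mass, whence the
mean value theorem compares the decrement with `binomialMass n m y`. -/
lemma exists_binomialTail_sub_eq {n m : ℕ} (hm : m < n) {p y : ℝ} (hp : p ∈ Set.Ioo (0 : ℝ) 1)
    (hy : y ∈ Set.Ioo (0 : ℝ) 1) : ∃ θ ∈ Set.Icc (0 : ℝ) 1,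
      binomialTail n m y - binomialTail n (m + 1) ((1 - p) * y) =
        binomialMass n m y * (1 + relativeDrop n m p y θ) := by
  have hlt : (1 - p) * y < y := by nlinarith [hp.1, hy.1]
  obtain ⟨ξ, hξ, hmv⟩ := exists_hasDerivAt_eq_slope (binomialTail n (m + 1)) _ hlt
    (fun z _ => (hasDerivAt_binomialTail_succ n m z).continuousAt.continuousWithinAt)
    (fun z _ => hasDerivAt_binomialTail_succ n m z)
  have hpy : 0 < p * y := mul_pos hp.1 hy.1
  refine ⟨(y - ξ) / (p * y), ⟨div_nonneg (by linarith [hξ.2]) hpy.le, ?_⟩, ?_⟩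
  · rw [div_le_one hpy]; linarith [hξ.1]
  have hy0 : y ≠ 0 := hy.1.ne'
  have hp0 : p ≠ 0 := hp.1.ne'
  have hξ1 : 1 - ξ ≠ 0 := by linarith [hξ.2, hy.2]
  have hy1 : 1 - y ≠ 0 := by linarith [hy.2]
  have hθ : 1 - (y - ξ) / (p * y) * p = ξ / y := by field_simp; ring
  have hθ' : ξ / y * y = ξ := by field_simp
  obtain ⟨d, rfl⟩ : ∃ d, n = m + d + 1 := ⟨n - m - 1, by omega⟩
  have hchoose : ((m + d + 1 : ℕ) : ℝ) * ((m + d).choose m : ℝ) =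
      (d + 1) * ((m + d + 1).choose m : ℝ) := by
    have := Nat.choose_mul_succ_eq (m + d) m
    rw [show m + d + 1 - m = d + 1 by omega] at this
    have h2 := congrArg (Nat.cast : ℕ → ℝ) this
    push_cast at h2 ⊢
    linarith
  rw [eq_div_iff (by linarith)] at hmv
  have h1 := binomialTail_succ (m + d + 1) m y
  have hmain : (m + d + 1 : ℕ) * binomialMass (m + d + 1 - 1) m ξ * (y - (1 - p) * y) =
      binomialMass (m + d + 1) m y * relativeDrop (m + d + 1) m p y ((y - ξ) / (p * y)) := by
    rw [relativeDrop, hθ, hθ', binomialMass, binomialMass, Nat.add_sub_cancel,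
      show m + d + 1 - m = d + 1 by omega, Nat.add_sub_cancel_left, div_pow, div_pow,
      ← mul_assoc, ← mul_assoc, hchoose]
    push_cast
    field_simp
    ring
  linarith

/-! ### Limits along a fixed proportion -/

/-- The filter on pairs `(n, m)` expressing that `n → ∞` and `m / n → t`. -/
noncomputable def proportionFilter (t : ℝ) : Filter (ℕ × ℕ) :=
  comap Prod.fst atTop ⊓ comap (fun z => (z.2 : ℝ) / z.1) (𝓝 t)

lemma tendsto_fst_proportionFilter (t : ℝ) :
    Tendsto (fun z : ℕ × ℕ => z.1) (proportionFilter t) atTop :=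
  tendsto_comap.mono_left inf_le_left

lemma tendsto_natCast_fst_proportionFilter (t : ℝ) :
    Tendsto (fun z : ℕ × ℕ => (z.1 : ℝ)) (proportionFilter t) atTop :=
  tendsto_natCast_atTop_atTop.comp (tendsto_fst_proportionFilter t)

lemma tendsto_div_proportionFilter (t : ℝ) :
    Tendsto (fun z : ℕ × ℕ => (z.2 : ℝ) / z.1) (proportionFilter t) (𝓝 t) :=
  tendsto_comap.mono_left inf_le_right

lemma tendsto_mk_proportionFilter {t : ℝ} {k : ℕ → ℕ}
    (hk : Tendsto (fun n => (k n : ℝ) / n) atTop (𝓝 t)) :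
    Tendsto (fun n => (n, k n)) atTop (proportionFilter t) :=
  tendsto_inf.2 ⟨tendsto_comap_iff.2 tendsto_id, tendsto_comap_iff.2 hk⟩

/-- A property that holds eventually along the filter holds, for all large `n`, in a whole window
`|m / n - t| < δ`. -/
lemma exists_pos_of_eventually_proportionFilter {t : ℝ} {Q : ℕ → ℕ → Prop}
    (h : ∀ᶠ z in proportionFilter t, Q z.1 z.2) :
    ∃ δ > 0, ∀ᶠ n : ℕ in atTop, ∀ m : ℕ, |(m : ℝ) / n - t| < δ → Q n m := by
  have hb := (atTop_basis.comap (Prod.fst : ℕ × ℕ → ℕ)).inf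
    ((Metric.nhds_basis_ball (x := t)).comap (fun z : ℕ × ℕ => (z.2 : ℝ) / z.1))
  obtain ⟨⟨N, δ⟩, ⟨-, hδ⟩, hsub⟩ := hb.eventually_iff.1 h
  refine ⟨δ, hδ, (eventually_ge_atTop N).mono fun n hn m hm => ?_⟩
  exact hsub (x := (n, m)) ⟨hn, by simpa [Real.dist_eq] using hm⟩

lemma tendsto_one_sub_div_pow (c t : ℝ) :
    Tendsto (fun z : ℕ × ℕ => (1 - c / z.1) ^ z.2) (proportionFilter t)
      (𝓝 (Real.exp (-(c * t)))) := by
  have hn := tendsto_natCast_fst_proportionFilter t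
  have hlog := (Real.tendsto_mul_log_one_add_div_atTop (-c)).comp hn
  have h := (Real.continuous_exp.tendsto _).comp
    ((tendsto_div_proportionFilter t).mul hlog)
  rw [show t * -c = -(c * t) by ring] at h
  refine h.congr' ?_
  filter_upwards [hn.eventually_gt_atTop (max c 0)] with z hz
  have hz0 : (0 : ℝ) < z.1 := (le_max_right _ _).trans_lt hz
  have hpos : 0 < 1 - c / z.1 := by
    rw [sub_pos, div_lt_one hz0]
    exact (le_max_left _ _).trans_lt hz
  rw [← Real.exp_log (pow_pos hpos z.2), Real.log_pow]
  simp only [Function.comp_apply]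
  congr 1
  rw [neg_div, ← sub_eq_add_neg]
  field_simp

lemma eventually_one_sub_div_mem_Ioo {c : ℝ} (hc : 0 < c) :
    ∀ᶠ n : ℕ in atTop, c / n ∈ Set.Ioo (0 : ℝ) 1 ∧ 1 - c / n ∈ Set.Ioo (0 : ℝ) 1 := by
  filter_upwards [tendsto_natCast_atTop_atTop.eventually_gt_atTop c] with n hn
  have h0 : 0 < c / n := div_pos hc (hc.trans hn)
  have h1 : c / n < 1 := (div_lt_one (hc.trans hn)).2 hn
  exact ⟨⟨h0, h1⟩, by linarith, by linarith⟩

lemma tendsto_one_div_mul_sq {η : ℝ} (hη : 0 < η) :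
    Tendsto (fun n : ℕ => 1 / (n * η ^ 2)) atTop (𝓝 0) :=
  tendsto_const_nhds.div_atTop (tendsto_natCast_atTop_atTop.atTop_mul_const (by positivity))

/-- If `t` lies below the limiting parameter `exp (-c t)`, the binomial variable exceeds `k n ~ t n`
with high probability. -/
lemma tendsto_binomialTail_one {c t : ℝ} (hc : 0 < c) (ht : t < Real.exp (-(c * t)))
    {k : ℕ → ℕ} (hk : Tendsto (fun n => (k n : ℝ) / n) atTop (𝓝 t)) :
    Tendsto (fun n : ℕ => binomialTail n (k n) ((1 - c / n) ^ k n)) atTop (𝓝 1) := by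
  obtain ⟨η, hη, hη'⟩ : ∃ η > 0, t + 3 * η = Real.exp (-(c * t)) :=
    ⟨(Real.exp (-(c * t)) - t) / 3, by linarith, by ring⟩
  have hy := (tendsto_one_sub_div_pow c t).comp (tendsto_mk_proportionFilter hk)
  have hy01 : ∀ᶠ n : ℕ in atTop, (1 - c / n) ^ k n ∈ Set.Icc (0 : ℝ) 1 :=
    (eventually_one_sub_div_mem_Ioo hc).mono fun n h =>
      ⟨pow_nonneg h.2.1.le _, pow_le_one₀ h.2.1.le h.2.2.le⟩
  have h0 : Tendsto (fun n : ℕ => 1 - binomialTail n (k n) ((1 - c / n) ^ k n)) atTop (𝓝 0) := by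
    refine tendsto_of_tendsto_of_tendsto_of_le_of_le' tendsto_const_nhds
      (tendsto_one_div_mul_sq hη) ?_ ?_
    · exact hy01.mono fun n hn => sub_nonneg.2 (binomialTail_le_one _ _ hn)
    · filter_upwards [hy01, eventually_gt_atTop 0,
        hk.eventually_lt_const (lt_add_of_pos_right t hη),
        hy.eventually_const_lt (sub_lt_self _ hη)] with n hn h1 h2 h3
      simp only [Function.comp_apply] at h3
      exact one_sub_binomialTail_le h1 hη hn (by linarith)
  simpa using h0.const_sub 1

/-- If `t` lies above the limiting parameter `exp (-c t)`, the binomial variable stays below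
`k n ~ t n` with high probability. -/
lemma tendsto_binomialTail_zero {c t : ℝ} (hc : 0 < c) (ht : Real.exp (-(c * t)) < t)
    {k : ℕ → ℕ} (hk : Tendsto (fun n => (k n : ℝ) / n) atTop (𝓝 t)) :
    Tendsto (fun n : ℕ => binomialTail n (k n) ((1 - c / n) ^ k n)) atTop (𝓝 0) := by
  obtain ⟨η, hη, hη'⟩ : ∃ η > 0, Real.exp (-(c * t)) + 3 * η = t :=
    ⟨(t - Real.exp (-(c * t))) / 3, by linarith, by ring⟩
  have hy := (tendsto_one_sub_div_pow c t).comp (tendsto_mk_proportionFilter hk)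
  have hy01 : ∀ᶠ n : ℕ in atTop, (1 - c / n) ^ k n ∈ Set.Icc (0 : ℝ) 1 :=
    (eventually_one_sub_div_mem_Ioo hc).mono fun n h =>
      ⟨pow_nonneg h.2.1.le _, pow_le_one₀ h.2.1.le h.2.2.le⟩
  refine tendsto_of_tendsto_of_tendsto_of_le_of_le' tendsto_const_nhds
    (tendsto_one_div_mul_sq hη) ?_ ?_
  · exact hy01.mono fun n hn => binomialTail_nonneg _ _ hn
  · filter_upwards [hy01, eventually_gt_atTop 0,
      hk.eventually_const_lt (sub_lt_self t hη),
      hy.eventually_lt_const (lt_add_of_pos_right _ hη)] with n hn h1 h2 h3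
    simp only [Function.comp_apply] at h3
    exact binomialTail_le h1 hη hn (by linarith)

/-- A form of `log (1 + u) = u (1 + o(1))` that also covers `u = 0`. -/
lemma log_one_add_eq_mul_dslope (u : ℝ) :
    Real.log (1 + u) = u * dslope Real.log 1 (1 + u) := by
  have := sub_smul_dslope Real.log 1 (1 + u)
  rw [Real.log_one, sub_zero, add_sub_cancel_left, smul_eq_mul] at this
  exact this.symm

lemma tendsto_dslope_log_one_add {ι : Type*} {l : Filter ι} {u : ι → ℝ} (hu : Tendsto u l (𝓝 0)) :
    Tendsto (fun i => dslope Real.log 1 (1 + u i)) l (𝓝 1) := by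
  have hc : ContinuousAt (dslope Real.log 1) 1 :=
    continuousAt_dslope_same.2 (Real.differentiableAt_log one_ne_zero)
  have h1 : dslope Real.log 1 1 = 1 := by rw [dslope_same, Real.deriv_log, inv_one]
  have := hc.tendsto.comp (by simpa using hu.const_add 1 : Tendsto (fun i => 1 + u i) l (𝓝 1))
  rwa [h1] at this

/-- The limit is uniform in `θ ∈ [0, 1]`, as needed for the unspecified intermediate point in
`exists_binomialTail_sub_eq`. -/
lemma tendsto_relativeDrop {c x : ℝ} (hc : 0 < c) (hx : x ∈ Set.Ioo (0 : ℝ) 1)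
    (hcx : Real.exp (-(c * x)) = x) :
    Tendsto (fun w : (ℕ × ℕ) × ℝ =>
        relativeDrop w.1.1 w.1.2 (c / w.1.1) ((1 - c / w.1.1) ^ w.1.2) w.2)
      (proportionFilter x ×ˢ 𝓟 (Set.Icc 0 1)) (𝓝 (c * x)) := by
  set L := proportionFilter x ×ˢ 𝓟 (Set.Icc (0 : ℝ) 1)
  have hx1 : 1 - x ≠ 0 := by linarith [hx.2]
  have hfst : Tendsto Prod.fst L (proportionFilter x) := tendsto_fst
  have hθ : ∀ᶠ w in L, w.2 ∈ Set.Icc (0 : ℝ) 1 :=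
    tendsto_snd.eventually (mem_principal_self (Set.Icc (0 : ℝ) 1))
  have hθ_mul : ∀ {v : (ℕ × ℕ) × ℝ → ℝ}, Tendsto v L (𝓝 0) →
      Tendsto (fun w => w.2 * v w) L (𝓝 0) := fun hv => by
    refine squeeze_zero_norm' (hθ.mono fun w hw => ?_) (tendsto_norm_zero.comp hv)
    rw [norm_mul, Real.norm_of_nonneg hw.1]
    exact mul_le_of_le_one_left (norm_nonneg _) hw.2
  have hn : Tendsto (fun w : (ℕ × ℕ) × ℝ => (w.1.1 : ℝ)) L atTop :=
    (tendsto_natCast_fst_proportionFilter x).comp hfst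
  have hr : Tendsto (fun w : (ℕ × ℕ) × ℝ => (w.1.2 : ℝ) / w.1.1) L (𝓝 x) :=
    (tendsto_div_proportionFilter x).comp hfst
  have hy : Tendsto (fun w : (ℕ × ℕ) × ℝ => (1 - c / w.1.1) ^ w.1.2) L (𝓝 x) := by
    have := (tendsto_one_sub_div_pow c x).comp hfst
    rwa [hcx] at this
  have hp : Tendsto (fun w : (ℕ × ℕ) × ℝ => c / w.1.1) L (𝓝 0) := tendsto_const_nhds.div_atTop hn
  have hθp := hθ_mul hp
  have hodds := hy.div (hy.const_sub 1) hx1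
  have hu : Tendsto (fun w : (ℕ × ℕ) × ℝ => -(w.2 * (c / w.1.1))) L (𝓝 0) := by
    simpa using hθp.neg
  have hv := hθp.mul hodds
  rw [zero_mul] at hv
  have hu' := tendsto_dslope_log_one_add hu
  have hv' := tendsto_dslope_log_one_add hv
  -- The logarithm of the product of powers is `θ` times a quantity whose two main terms cancel.
  have hB := ((hr.const_sub 1).mul_const c).mul (hodds.mul hv') |>.sub ((hr.mul_const c).mul hu')
  rw [show (1 - x) * c * (x / (1 - x) * 1) - x * c * 1 = 0 by field_simp; ring] at hB
  have hexp := (Real.continuous_exp.tendsto _).comp (hθ_mul hB)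
  rw [Real.exp_zero] at hexp
  have hden := ((hθp.const_sub 1).mul hy).const_sub 1
  rw [show 1 - (1 - 0) * x = 1 - x by ring] at hden
  have hmain := ((((hr.const_sub 1).mul_const c).mul hy).div hden hx1).mul hexp
  rw [show (1 - x) * c * x / (1 - x) * 1 = c * x by field_simp] at hmain
  refine hmain.congr' ?_
  filter_upwards [hθ, hn.eventually_gt_atTop 0, hr.eventually_lt_const hx.2,
    hy.eventually_const_lt hx.1, hy.eventually_lt_const hx.2, hu.eventually_const_lt
    (show (-1 : ℝ) < 0 by norm_num)] with ⟨⟨n, m⟩, θ⟩ h1 h2 h3 h4 h5 h6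
  simp only [Function.comp_apply, Pi.div_apply] at *
  set y := (1 - c / n) ^ m with hy_def
  have hmn : m ≤ n := by
    rw [div_lt_one h2] at h3
    exact_mod_cast h3.le
  have h7 : 0 < 1 - y := by linarith
  have hpos1 : 0 < 1 + -(θ * (c / n)) := by linarith
  have hpos2 : 0 < 1 + θ * (c / n) * (y / (1 - y)) := by
    have : 0 ≤ θ * (c / n) * (y / (1 - y)) :=
      mul_nonneg (mul_nonneg h1.1 (div_pos hc h2).le) (div_pos h4 h7).le
    linarith
  have e1 : (1 - θ * (c / n)) ^ m =
      Real.exp (m * Real.log (1 + -(θ * (c / n)))) := by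
    rw [← Real.log_pow, Real.exp_log (pow_pos hpos1 m), sub_eq_add_neg]
  have e2 : ((1 - (1 - θ * (c / n)) * y) / (1 - y)) ^ (n - m) =
      Real.exp ((n - m) * Real.log (1 + θ * (c / n) * (y / (1 - y)))) := by
    rw [← Nat.cast_sub hmn, ← Real.log_pow, Real.exp_log (pow_pos hpos2 _)]
    congr 1
    field_simp
    ring
  rw [relativeDrop, e1, e2, ← Real.exp_add, log_one_add_eq_mul_dslope (-(θ * (c / n))),
    log_one_add_eq_mul_dslope (θ * (c / n) * (y / (1 - y)))]
  congr 1
  · field_simp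
  · congr 1
    field_simp
    ring

/-! ### Comparison of the masses with the decrements of the tail -/

/-- The masses are dominated by the decrements of a function of `m` that drops from `1` to `0`. -/
lemma eventually_binomialMass_le_sub {c : ℝ} (hc : 0 < c) :
    ∀ᶠ n : ℕ in atTop, ∀ m : ℕ, 0 ≤ binomialMass n m ((1 - c / n) ^ m) ∧
      binomialMass n m ((1 - c / n) ^ m) ≤ binomialTail n m ((1 - c / n) ^ m) -
        binomialTail n (m + 1) ((1 - c / n) ^ (m + 1)) := by
  filter_upwards [eventually_one_sub_div_mem_Ioo hc] with n hn m
  have hmem : ∀ k, (1 - c / n) ^ k ∈ Set.Icc (0 : ℝ) 1 := fun k =>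
    ⟨pow_nonneg hn.2.1.le _, pow_le_one₀ hn.2.1.le hn.2.2.le⟩
  refine ⟨binomialMass_nonneg _ _ (hmem m), ?_⟩
  have h1 := binomialTail_succ n m ((1 - c / n) ^ m)
  have h2 := monotoneOn_binomialTail n (m + 1) (hmem (m + 1)) (hmem m)
    (pow_le_pow_of_le_one hn.2.1.le hn.2.2.le m.le_succ)
  linarith

/-- Since the decrement is asymptotically `1 + c * x` times the mass, a weighted mass is a multiple of
the decrement up to a small relative error. -/
lemma eventually_abs_binomialMass_mul_sub_le {c x : ℝ} (hc : 0 < c) (hx : x ∈ Set.Ioo (0 : ℝ) 1)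
    (hcx : Real.exp (-(c * x)) = x) {g : ℕ → ℕ → ℝ} {G ε : ℝ} (hε : 0 < ε)
    (hg : Tendsto (fun z : ℕ × ℕ => g z.1 z.2) (proportionFilter x) (𝓝 G)) :
    ∀ᶠ z in proportionFilter x,
      |binomialMass z.1 z.2 ((1 - c / z.1) ^ z.2) * g z.1 z.2 - G / (1 + c * x) *
        (binomialTail z.1 z.2 ((1 - c / z.1) ^ z.2) -
          binomialTail z.1 (z.2 + 1) ((1 - c / z.1) ^ (z.2 + 1)))| ≤
      ε * binomialMass z.1 z.2 ((1 - c / z.1) ^ z.2) := by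
  have hpos : 0 < 1 + c * x := by have := mul_pos hc hx.1; linarith
  have hlim := (hg.comp (tendsto_fst (g := 𝓟 (Set.Icc (0 : ℝ) 1)))).sub
    (((tendsto_relativeDrop hc hx hcx).const_add 1).const_mul (G / (1 + c * x)))
  rw [div_mul_cancel₀ _ hpos.ne', sub_self] at hlim
  have hsmall := eventually_prod_principal_iff.1 (hlim.abs.eventually_le_const
    (show |(0 : ℝ)| < ε by simpa using hε))
  have hy := tendsto_one_sub_div_pow c x
  rw [hcx] at hy
  filter_upwards [hsmall, hy.eventually_const_lt hx.1, hy.eventually_lt_const hx.2,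
    (tendsto_fst_proportionFilter x).eventually (eventually_one_sub_div_mem_Ioo hc),
    (tendsto_fst_proportionFilter x).eventually (eventually_gt_atTop 0),
    (tendsto_div_proportionFilter x).eventually_lt_const hx.2] with ⟨n, m⟩ h1 h2 h3 h4 h5 h6
  simp only [Function.comp_apply] at *
  have hmn : m < n := by
    rw [div_lt_one (Nat.cast_pos.2 h5)] at h6
    exact_mod_cast h6
  obtain ⟨θ, hθ, heq⟩ := exists_binomialTail_sub_eq hmn h4.1 ⟨h2, h3⟩
  have hT := binomialMass_nonneg n m ⟨h2.le, h3.le⟩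
  rw [pow_succ', heq, show ∀ T g K R : ℝ, T * g - K * (T * R) = (g - K * R) * T by intros; ring,
    abs_mul, abs_of_nonneg hT]
  exact mul_le_mul_of_nonneg_right (h1 θ hθ) hT

/-- The decrements of a nonnegative antitone sequence outside of the window `[lo, hi)`. -/
lemma sum_decrements_outside_le {F : ℕ → ℝ} (hF : Antitone F) (h0 : ∀ k, 0 ≤ F k) (n lo hi : ℕ) :
    ∑ m ∈ Finset.range n, (if m < lo ∨ hi ≤ m then F m - F (m + 1) else 0) ≤
      F 0 - F lo + F hi := by
  have hD : ∀ m, 0 ≤ F m - F (m + 1) := fun m => sub_nonneg.2 (hF m.le_succ)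
  have h1 : ∑ m ∈ Finset.range n, (if m < lo then F m - F (m + 1) else 0) ≤ F 0 - F lo := by
    rw [← Finset.sum_filter, ← Finset.sum_range_sub']
    refine Finset.sum_le_sum_of_subset_of_nonneg (fun m hm => ?_) fun m _ _ => hD m
    simp only [Finset.mem_filter, Finset.mem_range] at hm ⊢
    exact hm.2
  have h2 : ∑ m ∈ Finset.range n, (if hi ≤ m then F m - F (m + 1) else 0) ≤ F hi := by
    have h3 : ∑ m ∈ Finset.Ico hi (hi + n), (F m - F (m + 1)) = F hi - F (hi + n) := by
      rw [Finset.sum_Ico_eq_sum_range, Nat.add_sub_cancel_left]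
      exact Finset.sum_range_sub' (fun k => F (hi + k)) n
    rw [← Finset.sum_filter]
    refine (Finset.sum_le_sum_of_subset_of_nonneg (fun m hm => ?_) fun m _ _ => hD m).trans
      (h3.trans_le (sub_le_self _ (h0 _)))
    simp only [Finset.mem_filter, Finset.mem_range, Finset.mem_Ico] at hm ⊢
    omega
  refine le_trans ?_ (add_le_add h1 h2)
  rw [← Finset.sum_add_distrib]
  refine Finset.sum_le_sum fun m _ => ?_
  have := hD m
  split_ifs <;> first | omega | linarith

/-- The sum concentrates near `m = x * n`, where the weights are close to `G` and the masses sum up to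
almost `1 / (1 + c * x)`. -/
theorem tendsto_sum_binomialMass_mul {c x : ℝ} (hc : 0 < c) (hx : x ∈ Set.Ioo (0 : ℝ) 1)
    (hcx : Real.exp (-(c * x)) = x) {g : ℕ → ℕ → ℝ} {G C : ℝ}
    (hg : Tendsto (fun z : ℕ × ℕ => g z.1 z.2) (proportionFilter x) (𝓝 G))
    (hC : ∀ᶠ n : ℕ in atTop, ∀ m ≤ n, |g n m| ≤ C) :
    Tendsto (fun n : ℕ => ∑ m ∈ Finset.range (n + 1),
      binomialMass n m ((1 - c / n) ^ m) * g n m) atTop (𝓝 (G / (1 + c * x))) := by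
  set K := G / (1 + c * x) with hK
  set F : ℕ → ℕ → ℝ := fun n m => binomialTail n m ((1 - c / n) ^ m) with hF
  rw [Metric.tendsto_nhds]
  intro ε hε
  obtain ⟨δ₀, hδ₀, hwin₀⟩ := exists_pos_of_eventually_proportionFilter
    (Q := fun n m => |binomialMass n m ((1 - c / n) ^ m) * g n m - K * (F n m - F n (m + 1))| ≤
      ε / 2 * binomialMass n m ((1 - c / n) ^ m))
    (eventually_abs_binomialMass_mul_sub_le hc hx hcx (half_pos hε) hg)
  obtain ⟨δ, hδ, hδδ₀, hδx⟩ : ∃ δ > 0, δ < δ₀ ∧ δ ≤ x :=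
    ⟨min (δ₀ / 2) x, lt_min (half_pos hδ₀) hx.1,
      (min_le_left _ _).trans_lt (half_lt_self hδ₀), min_le_right _ _⟩
  have hlo : Tendsto (fun n : ℕ => F n ⌈(x - δ) * n⌉₊) atTop (𝓝 1) := by
    refine tendsto_binomialTail_one hc (t := x - δ) ?_
      ((tendsto_nat_ceil_mul_div_atTop (by linarith)).comp tendsto_natCast_atTop_atTop)
    have := Real.exp_lt_exp.2 (show -(c * x) < -(c * (x - δ)) by nlinarith)
    linarith
  have hhi : Tendsto (fun n : ℕ => F n ⌈(x + δ) * n⌉₊) atTop (𝓝 0) := by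
    refine tendsto_binomialTail_zero hc (t := x + δ) ?_
      ((tendsto_nat_ceil_mul_div_atTop (by linarith)).comp tendsto_natCast_atTop_atTop)
    have := Real.exp_lt_exp.2 (show -(c * (x + δ)) < -(c * x) by nlinarith)
    linarith
  have hout := ((hlo.const_sub 1).add hhi).const_mul (C + |K|)
  rw [sub_self, zero_add, mul_zero] at hout
  filter_upwards [hwin₀, hC, eventually_binomialMass_le_sub hc, eventually_gt_atTop 0,
    hout.eventually_lt_const (half_pos hε)] with n hwin hC hT hn hsmall
  have hn' : (0 : ℝ) < n := Nat.cast_pos.2 hn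
  have hC0 : 0 ≤ C := (abs_nonneg _).trans (hC 0 (Nat.zero_le n))
  have hanti : Antitone (F n) := antitone_nat_of_succ_le fun m => by
    have := hT m
    simp only [hF]
    linarith
  have hF0 : F n 0 = 1 := binomialTail_zero _ _
  have hFn : ∀ k, n < k → F n k = 0 := fun k hk => binomialTail_of_lt hk _
  have hnonneg : ∀ k, 0 ≤ F n k := fun k => by
    have := hanti (le_max_left k (n + 1))
    rwa [hFn _ (Nat.lt_of_lt_of_le n.lt_succ_self (le_max_right _ _))] at this
  -- The decrements telescope, and outside of the window they serve as an upper bound.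
  have htele : ∑ m ∈ Finset.range (n + 1), (F n m - F n (m + 1)) = 1 := by
    rw [Finset.sum_range_sub' (F n), hF0, hFn _ n.lt_succ_self, sub_zero]
  have hterm : ∀ m ∈ Finset.range (n + 1),
      |binomialMass n m ((1 - c / n) ^ m) * g n m - K * (F n m - F n (m + 1))| ≤
        ε / 2 * (F n m - F n (m + 1)) + (C + |K|) *
          (if m < ⌈(x - δ) * n⌉₊ ∨ ⌈(x + δ) * n⌉₊ ≤ m then F n m - F n (m + 1) else 0) := by
    intro m hm
    obtain ⟨hT0, hTD⟩ := hT m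
    have hD0 : 0 ≤ F n m - F n (m + 1) := hT0.trans hTD
    split_ifs with hcase
    · have h1 := hC m (by rw [Finset.mem_range] at hm; omega)
      have h2 : |binomialMass n m ((1 - c / n) ^ m) * g n m| ≤ (F n m - F n (m + 1)) * C := by
        rw [abs_mul, abs_of_nonneg hT0]
        exact mul_le_mul hTD h1 (abs_nonneg _) hD0
      have h3 : |K * (F n m - F n (m + 1))| = |K| * (F n m - F n (m + 1)) := by
        rw [abs_mul, abs_of_nonneg hD0]
      have h4 := abs_sub (binomialMass n m ((1 - c / n) ^ m) * g n m) (K * (F n m - F n (m + 1)))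
      have h5 := mul_nonneg (half_pos hε).le hD0
      linarith
    · push Not at hcase
      rw [Nat.ceil_le, Nat.lt_ceil] at hcase
      have h1 : |(m : ℝ) / n - x| ≤ δ := by
        rw [abs_le, neg_le_sub_iff_le_add, sub_le_iff_le_add]
        have h2 : x - δ ≤ m / n := (le_div_iff₀ hn').2 hcase.1
        have h3 : (m : ℝ) / n ≤ x + δ := (div_le_iff₀ hn').2 hcase.2.le
        exact ⟨by linarith, by linarith⟩
      rw [mul_zero, add_zero]
      exact (hwin m (h1.trans_lt hδδ₀)).trans (mul_le_mul_of_nonneg_left hTD (half_pos hε).le)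
  have hsum : ∑ m ∈ Finset.range (n + 1), binomialMass n m ((1 - c / n) ^ m) * g n m - K =
      ∑ m ∈ Finset.range (n + 1),
        (binomialMass n m ((1 - c / n) ^ m) * g n m - K * (F n m - F n (m + 1))) := by
    rw [Finset.sum_sub_distrib, ← Finset.mul_sum, htele, mul_one]
  rw [Real.dist_eq, hsum]
  refine (Finset.abs_sum_le_sum_abs _ _).trans_lt ((Finset.sum_le_sum hterm).trans_lt ?_)
  rw [Finset.sum_add_distrib, ← Finset.mul_sum, ← Finset.mul_sum, htele, mul_one]
  have h6 := mul_le_mul_of_nonneg_left (sum_decrements_outside_le hanti hnonneg (n + 1)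
    ⌈(x - δ) * n⌉₊ ⌈(x + δ) * n⌉₊) (add_nonneg hC0 (abs_nonneg K))
  rw [hF0] at h6
  linarith

/-! ### The limit of the expected number of answer sets -/

lemma existsUnique_log_eq_div {c : ℝ} (hc : 0 < c) :
    ∃ α : ℝ, 1 < α ∧ ∀ β : ℝ, 0 < β → (Real.log β = c / β ↔ β = α) := by
  have hmono : StrictMonoOn (fun β : ℝ => Real.log β - c / β) (Set.Ioi 0) := by
    intro a ha b hb hab
    have h1 := Real.log_lt_log ha hab
    have h2 := div_le_div_of_nonneg_left hc.le ha hab.le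
    simp only
    linarith
  have hcont : ContinuousOn (fun β : ℝ => Real.log β - c / β) (Set.Icc 1 (Real.exp c)) := by
    have : ∀ β ∈ Set.Icc 1 (Real.exp c), β ≠ 0 := fun β hβ => by linarith [hβ.1]
    exact (Real.continuousOn_log.mono this).sub (continuousOn_const.div continuousOn_id this)
  have h1e : 1 < Real.exp c := Real.one_lt_exp_iff.2 hc
  obtain ⟨α, hα, hα0⟩ := intermediate_value_Icc h1e.le hcont
    (show (0 : ℝ) ∈ Set.Icc _ _ by
      simp only [Real.log_one, Real.log_exp, div_one, Set.mem_Icc, zero_sub, sub_nonneg]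
      exact ⟨by linarith, div_le_self hc.le h1e.le⟩)
  have hα1 : 1 < α := by
    refine lt_of_le_of_ne hα.1 fun h => ?_
    rw [← h] at hα0
    simp only [Real.log_one, div_one] at hα0
    linarith
  refine ⟨α, hα1, fun β hβ => ⟨fun h => ?_, ?_⟩⟩
  · exact hmono.injOn hβ (show (0 : ℝ) < α by linarith)
      (by simp only at hα0 ⊢; rw [hα0, h, sub_self])
  · rintro rfl
    exact sub_eq_zero.1 hα0

lemma eventually_ruleProb_mem_Icc {c₁ c₂ : ℝ} (hc₁ : 0 < c₁) (hc₂ : 0 ≤ c₂) :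
    ∀ᶠ n : ℕ in atTop, ∀ r, ruleProb c₁ c₂ n r ∈ Set.Icc 0 1 := by
  filter_upwards [tendsto_natCast_atTop_atTop.eventually_gt_atTop (max c₁ c₂)] with n hn r
  have h1 := (le_max_left _ _).trans_lt hn
  have h2 := (le_max_right _ _).trans_lt hn
  have h0 : (0 : ℝ) < n := hc₁.trans h1
  rw [ruleProb]
  split_ifs
  · exact ⟨div_nonneg hc₂ h0.le, (div_le_one h0).2 h2.le⟩
  · exact ⟨div_nonneg hc₁.le h0.le, (div_le_one h0).2 h1.le⟩

/-- Writing `(1 - p) ^ (m * (m - 1)) = ((1 - p) ^ m) ^ m / (1 - p) ^ m` turns each summand of the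
expected value into a binomial mass times a weight. -/
lemma integral_numAnswerSets_eq_sum_binomialMass {c₁ c₂ : ℝ} {n : ℕ}
    (h : ∀ r, ruleProb c₁ c₂ n r ∈ Set.Icc 0 1) (hp : 1 - c₁ / n ≠ 0) :
    ∫ E, (numAnswerSets E : ℝ) ∂linearModel c₁ c₂ n =
      ∑ m ∈ Finset.range (n + 1), binomialMass n m ((1 - c₁ / n) ^ m) *
        ((1 - c₂ / n) ^ m / (1 - c₁ / n) ^ m) := by
  rw [integral_numAnswerSets h]
  refine Finset.sum_congr rfl fun m _ => ?_
  rw [binomialMass]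
  cases m with
  | zero => simp
  | succ k =>
    have hpow : ((1 - c₁ / n) ^ (k + 1)) ^ (k + 1) =
        ((1 - c₁ / n) ^ k) ^ (k + 1) * (1 - c₁ / n) ^ (k + 1) := by
      rw [← mul_pow, ← pow_succ]
    have hne : (1 - c₁ / n) ^ (k + 1) ≠ 0 := pow_ne_zero _ hp
    rw [Nat.add_sub_cancel, mul_pow, hpow, mul_div_assoc', eq_div_iff hne]
    ring

lemma tendsto_integral_numAnswerSets {c₁ c₂ x : ℝ} (hc₁ : 0 < c₁) (hc₂ : 0 ≤ c₂)
    (hx : x ∈ Set.Ioo (0 : ℝ) 1) (hcx : Real.exp (-(c₁ * x)) = x) :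
    Tendsto (fun n : ℕ => ∫ E, (numAnswerSets E : ℝ) ∂linearModel c₁ c₂ n) atTop
      (𝓝 (Real.exp ((c₁ - c₂) * x) / (1 + c₁ * x))) := by
  have hg : Tendsto (fun z : ℕ × ℕ => (1 - c₂ / z.1) ^ z.2 / (1 - c₁ / z.1) ^ z.2)
      (proportionFilter x) (𝓝 (Real.exp ((c₁ - c₂) * x))) := by
    have := (tendsto_one_sub_div_pow c₂ x).div (tendsto_one_sub_div_pow c₁ x) (Real.exp_ne_zero _)
    rw [← Real.exp_sub, show -(c₂ * x) - -(c₁ * x) = (c₁ - c₂) * x by ring] at this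
    exact this
  have hpow := (tendsto_one_sub_div_pow c₁ 1).comp (tendsto_mk_proportionFilter (k := id)
    (tendsto_const_nhds.congr' ((eventually_gt_atTop 0).mono fun n hn =>
      (div_self (Nat.cast_ne_zero.2 hn.ne')).symm)))
  -- The weights are at most `(1 - c₁ / n) ^ (-n)`, which tends to `exp c₁`.
  have hbound : ∀ᶠ n : ℕ in atTop, ∀ m ≤ n,
      |(1 - c₂ / n) ^ m / (1 - c₁ / n) ^ m| ≤ 2 * Real.exp c₁ := by
    filter_upwards [hpow.eventually_const_lt (show Real.exp (-(c₁ * 1)) / 2 < _ from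
      half_lt_self (Real.exp_pos _)), eventually_one_sub_div_mem_Ioo hc₁,
      tendsto_natCast_atTop_atTop.eventually_ge_atTop c₂] with n h1 h2 h3 m hm
    simp only [Function.comp_apply, id, mul_one] at h1
    have h4 : 0 ≤ 1 - c₂ / n := sub_nonneg.2 (div_le_one_of_le₀ h3 (Nat.cast_nonneg n))
    have h5 : (1 - c₂ / n) ^ m ≤ 1 :=
      pow_le_one₀ h4 (by linarith [div_nonneg hc₂ (Nat.cast_nonneg (α := ℝ) n)])
    have h6 := pow_le_pow_of_le_one h2.2.1.le h2.2.2.le hm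
    have h7 := pow_pos h2.2.1 m
    rw [abs_of_nonneg (div_nonneg (pow_nonneg h4 m) h7.le), div_le_iff₀ h7]
    calc (1 - c₂ / n) ^ m ≤ 2 * Real.exp c₁ * (Real.exp (-c₁) / 2) := by
          rw [Real.exp_neg]
          field_simp
          exact h5
      _ ≤ _ := mul_le_mul_of_nonneg_left (h1.le.trans h6) (by positivity)
  have hmain := tendsto_sum_binomialMass_mul hc₁ hx hcx
    (g := fun n m => (1 - c₂ / n) ^ m / (1 - c₁ / n) ^ m) hg hbound
  refine hmain.congr' ?_
  filter_upwards [eventually_ruleProb_mem_Icc hc₁ hc₂, eventually_one_sub_div_mem_Ioo hc₁]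
    with n h1 h2
  exact (integral_numAnswerSets_eq_sum_binomialMass h1 h2.2.1.ne').symm

lemma tendsto_linearModel_real_empty {c₁ c₂ : ℝ} (hc₁ : 0 < c₁) (hc₂ : 0 ≤ c₂) :
    Tendsto (fun n : ℕ => (linearModel c₁ c₂ n).real {∅}) atTop (𝓝 0) := by
  have hexp : Tendsto (fun n : ℕ => Real.exp (-(c₁ * (n - 1)))) atTop (𝓝 0) := by
    refine Real.tendsto_exp_neg_atTop_nhds_zero.comp (Tendsto.const_mul_atTop hc₁ ?_)
    exact tendsto_atTop_add_const_right _ _ tendsto_natCast_atTop_atTop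
  refine squeeze_zero' (Eventually.of_forall fun n => measureReal_nonneg) ?_ hexp
  filter_upwards [eventually_ruleProb_mem_Icc hc₁ hc₂, eventually_one_sub_div_mem_Ioo hc₁,
    tendsto_natCast_atTop_atTop.eventually_ge_atTop c₂, eventually_gt_atTop 0] with n h1 h2 h3 h4
  have h5 : 0 ≤ 1 - c₂ / n := sub_nonneg.2 (div_le_one_of_le₀ h3 (Nat.cast_nonneg n))
  have h6 : 1 - c₂ / n ≤ 1 := by linarith [div_nonneg hc₂ (Nat.cast_nonneg (α := ℝ) n)]
  have h7 : 1 - c₁ / n ≤ Real.exp (-(c₁ / n)) := Real.one_sub_le_exp_neg _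
  have hn0 : (n : ℝ) ≠ 0 := Nat.cast_ne_zero.2 h4.ne'
  rw [linearModel_real_empty h1]
  calc ((1 - c₁ / n) ^ (n - 1) * (1 - c₂ / n)) ^ n
      ≤ (Real.exp (-(c₁ / n)) ^ (n - 1) * 1) ^ n := by
        have := h2.2.1.le
        gcongr
    _ = Real.exp (-(c₁ * (n - 1))) := by
        rw [mul_one, ← Real.exp_nat_mul, ← Real.exp_nat_mul, Nat.cast_sub h4]
        congr 1
        push_cast
        field_simp

end ASP

theorem mainTheorem1 (c₁ c₂ : ℝ) (hc₁ : 0 < c₁) (hc₂ : 0 ≤ c₂) :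
    ∃ α : ℝ, 1 < α ∧
      (∀ β : ℝ, 0 < β → (Real.log β = c₁ / β ↔ β = α)) ∧
      Tendsto (fun n : ℕ => ∫ E, (ASP.numAnswerSets E : ℝ) ∂(ASP.linearModel c₁ c₂ n)) atTop
        (𝓝 (α * Real.exp ((c₁ - c₂) / α) / (α + c₁))) ∧
      Tendsto
        (fun n : ℕ => ∫ E, (ASP.numAnswerSets E : ℝ)
          ∂(ProbabilityTheory.cond (ASP.linearModel c₁ c₂ n) {E | E.Nonempty})) atTop
        (𝓝 (α * Real.exp ((c₁ - c₂) / α) / (α + c₁))) := by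
  obtain ⟨α, hα1, hα⟩ := ASP.existsUnique_log_eq_div hc₁
  have hα0 : 0 < α := by linarith
  have hlog : Real.log α = c₁ / α := (hα α hα0).2 rfl
  -- The proportion `x = α⁻¹` is the fixed point of `exp (-c₁ x)`.
  have hcx : Real.exp (-(c₁ * α⁻¹)) = α⁻¹ := by
    rw [← div_eq_mul_inv, ← hlog, Real.exp_neg, Real.exp_log hα0]
  have hlim := ASP.tendsto_integral_numAnswerSets hc₁ hc₂
    ⟨inv_pos.2 hα0, inv_lt_one_of_one_lt₀ hα1⟩ hcx
  rw [show Real.exp ((c₁ - c₂) * α⁻¹) / (1 + c₁ * α⁻¹) =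
    α * Real.exp ((c₁ - c₂) / α) / (α + c₁) by rw [← div_eq_mul_inv]; field_simp] at hlim
  refine ⟨α, hα1, hα, hlim, ?_⟩
  have hempty := ASP.tendsto_linearModel_real_empty hc₁ hc₂
  have hcond := ((hempty.const_sub 1).inv₀ (by norm_num)).mul (hlim.sub hempty)
  rw [sub_zero, sub_zero, inv_one, one_mul] at hcond
  refine hcond.congr' ?_
  filter_upwards [ASP.eventually_ruleProb_mem_Icc hc₁ hc₂] with n hn
  exact (ASP.integral_numAnswerSets_cond_nonempty hn).symm
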